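/- Let a group $G$ act by isometries on a geodesic metric space $(X,d)$ and let $o\in X$. For $A\subseteq X$ write $N_r(A)=\{x : d(x,A)\le r\}$ and $\pi_A(x)=\{y\in\overline A : d(x,y)=d(x,A)\}$. A subset $Y\subseteq X$ is $C$-contracting ($C\ge 0$) if $\operatorname{diam}\big(\bigcup_{x\in\alpha}\pi_Y(x)\big)\le C$ for every geodesic segment $\alpha$ with $d(\alpha,Y)\ge C$. An element $h\in G$ is contracting if $\langle h\rangle o$ is $C$-contracting for some $C\geq 0$ and $n\mapsto h^n o$ is a quasi-isometric embedding $\mathbb Z\to X$. Two contracting elements $g,h$ are weakly independent if for every $r\ge 0$ the set $N_r(\langle g\rangle o)\cap N_r(\langle h\rangle o)$ has finite diameter, bounded by some function of $r$. Suppose the action has three pairwise weakly independent contracting elements $h_1,h_2,h_3\in G$ (such elements exist as soon as there are two weakly independent contracting elements, i.e. as soon as the action has the contracting property). Put $\mathcal F_o=\{g\langle h_i\rangle o : g\in G,\ 1\le i\le 3\}$ and let $C\ge 0$ be such that every $Z\in\mathcal F_o$ is $C$-contracting. For $L>0$, a point $x$ of a geodesic segment $\gamma$ is $(\mathcal F_o,L)$-transversal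 if there is $Z\in\mathcal F_o$ such that $\operatorname{diam}(\gamma\cap N_C(Z))>L$ and $x$ is the entry point or the exit point of $\gamma$ in $N_C(Z)$, that is, the first or the last point of $\gamma\cap N_C(Z)$ along $\gamma$. A left-invariant metric, or more generally pseudo-metric, $d_G$ on $G$ is coarsely additive along $(\mathcal F_o,L)$-transversal points if there is a function $R$ such that for all $r>0$ and all $g,f,h\in G$: if $fo$ is at distance at most $r$ from an $(\mathcal F_o,L)$-transversal point of some geodesic segment from $go$ to $ho$, then $$|d_G(g,h)-d_G(g,f)-d_G(f,h)|\le R(r).$$ Theorem. Let $d_1,d_2$ be left-invariant metrics (or, more generally, pseudo-metrics) on $G$ which, for some $L>0$, are both coarsely additive along $(\mathcal F_o,L)$-transversal points. Let $\ell_{d_i}(g)=\lim_{n\to\infty} d_i(1,g^n)/n$. If $\ell_{d_1}(g)=\ell_{d_2}(g)$ for all $g\in G$, then $$\sup_{g,h\in G}|d_1(g,h)-d_2(g,h)|<\infty,$$ equivalently $\sup_{g\in G}|d_1(1,g)-d_2(1,g)|<\infty$. -/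

import Mathlib

open Set Filter Topology
open scoped Pointwise

/-! ### Geodesics, closest-point projections, contracting subsets -/

/-- `γ`, restricted to `[0, ℓ]`, is a geodesic segment of length `ℓ`
(the values of `γ` outside `[0, ℓ]` play no role). -/
structure IsGeodesicSegment {X : Type*} [MetricSpace X] (γ : ℝ → X) (ℓ : ℝ) : Prop where
  length_nonneg : 0 ≤ ℓ
  dist_eq : ∀ s ∈ Icc 0 ℓ, ∀ t ∈ Icc 0 ℓ, dist (γ s) (γ t) = |s - t|

/-- Any two points are joined by a geodesic segment. -/
def IsGeodesicSpace (X : Type*) [MetricSpace X] : Prop :=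
  ∀ x y : X, ∃ (γ : ℝ → X) (ℓ : ℝ), IsGeodesicSegment γ ℓ ∧ γ 0 = x ∧ γ ℓ = y

/-- The closest-point projection `π_A(x)`, a set of points of the closure of `A`. -/
def closestPoints {X : Type*} [MetricSpace X] (A : Set X) (x : X) : Set X :=
  {y | y ∈ closure A ∧ dist x y = Metric.infDist x A}

/-- `Y` is `C`-contracting: every geodesic segment `γ` with `d(γ, Y) ≥ C` has a projection
`π_Y(γ)` of diameter at most `C`. -/
structure IsContractingSet {X : Type*} [MetricSpace X] (C : ℝ) (Y : Set X) : Prop where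
  const_nonneg : 0 ≤ C
  dist_le : ∀ (γ : ℝ → X) (ℓ : ℝ), IsGeodesicSegment γ ℓ →
    (∀ t ∈ Icc 0 ℓ, C ≤ Metric.infDist (γ t) Y) →
    ∀ s ∈ Icc 0 ℓ, ∀ t ∈ Icc 0 ℓ,
      ∀ u ∈ closestPoints Y (γ s), ∀ v ∈ closestPoints Y (γ t), dist u v ≤ C

/-- `Y` and `Z` have bounded intersection: there is a gauge `ρ` with
`diam (N_r(Y) ∩ N_r(Z)) ≤ ρ r` for all `r ≥ 0`, where `N_r` is the closed `r`-neighbourhood. -/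
def HasBoundedIntersection {X : Type*} [MetricSpace X] (Y Z : Set X) : Prop :=
  ∃ ρ : ℝ → ℝ, ∀ r : ℝ, 0 ≤ r →
    ∀ x ∈ Metric.cthickening r Y ∩ Metric.cthickening r Z,
    ∀ y ∈ Metric.cthickening r Y ∩ Metric.cthickening r Z, dist x y ≤ ρ r

/-! ### Contracting elements of a group action -/

/-- The orbit `⟨h⟩ o` of the basepoint under the cyclic group generated by `h`. -/
def cyclicOrbit {G X : Type*} [Group G] [MulAction G X] (h : G) (o : X) : Set X :=
  range fun n : ℤ => h ^ n • o

/-- `h` is a contracting element: `⟨h⟩ o` is a contracting subset and `n ↦ h ^ n • o` is a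
quasi-isometric embedding of `ℤ`. -/
structure IsContractingElement {G X : Type*} [Group G] [MetricSpace X] [MulAction G X]
    (h : G) (o : X) : Prop where
  contracting : ∃ C : ℝ, IsContractingSet C (cyclicOrbit h o)
  quasiIsometric : ∃ a c : ℝ, 1 ≤ a ∧ 0 ≤ c ∧ ∀ m n : ℤ,
    a⁻¹ * |(m : ℝ) - n| - c ≤ dist (h ^ m • o) (h ^ n • o) ∧
      dist (h ^ m • o) (h ^ n • o) ≤ a * |(m : ℝ) - n| + c

/-- Weak independence of two (contracting) elements. -/
def WeaklyIndependent {G X : Type*} [Group G] [MetricSpace X] [MulAction G X]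
    (g h : G) (o : X) : Prop :=
  HasBoundedIntersection (cyclicOrbit g o) (cyclicOrbit h o)

/-- The system `𝓕_o = {g ⟨h_i⟩ o | g ∈ G, i}` of translated axes. -/
def axisSystem {G X ι : Type*} [Group G] [MulAction G X] (h : ι → G) (o : X) : Set (Set X) :=
  {Z | ∃ (g : G) (i : ι), Z = g • cyclicOrbit (h i) o}

/-! ### Transversal points and coarse additivity -/

/-- `x` is an `(𝓕, L)`-transversal point of the geodesic segment `γ` of length `ℓ`, relative to
the constant `C`: for some `Z ∈ 𝓕` the set `γ ∩ N_C(Z)` has diameter greater than `L`, and `x` is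
its entry point or its exit point. (The set is bounded, so its diameter is a genuine one.) -/
def IsTransversalPoint {X : Type*} [MetricSpace X] (𝓕 : Set (Set X)) (C L : ℝ)
    (γ : ℝ → X) (ℓ : ℝ) (x : X) : Prop :=
  ∃ Z ∈ 𝓕, L < Metric.diam (γ '' Icc 0 ℓ ∩ Metric.cthickening C Z) ∧
    ∃ t : ℝ, x = γ t ∧
      (IsLeast {s | s ∈ Icc 0 ℓ ∧ γ s ∈ Metric.cthickening C Z} t ∨
        IsGreatest {s | s ∈ Icc 0 ℓ ∧ γ s ∈ Metric.cthickening C Z} t)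

/-- Left-invariance of a (pseudo-)metric on a group. -/
def IsLeftInvariant {G : Type*} [Group G] (d : PseudoMetricSpace G) : Prop :=
  ∀ k g h : G, d.dist (k * g) (k * h) = d.dist g h

/-- `d` is coarsely additive along `(𝓕, L)`-transversal points: whenever `f o` is `r`-close to an
`(𝓕, L)`-transversal point of a geodesic segment from `g o` to `h o`, the defect of additivity at
`f` is at most `R r`, where `R` depends only on `r`. -/
def IsCoarselyAdditive {G X : Type*} [Group G] [MetricSpace X] [MulAction G X]
    (d : PseudoMetricSpace G) (o : X) (𝓕 : Set (Set X)) (C L : ℝ) : Prop :=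
  ∃ R : ℝ → ℝ, ∀ r : ℝ, 0 < r → ∀ (g f h : G) (γ : ℝ → X) (ℓ : ℝ),
    IsGeodesicSegment γ ℓ → γ 0 = g • o → γ ℓ = h • o →
    (∃ x : X, IsTransversalPoint 𝓕 C L γ ℓ x ∧ dist (f • o) x ≤ r) →
    |d.dist g h - d.dist g f - d.dist f h| ≤ R r

/-! ### Marked length spectrum -/

/-- The stable translation length `lim d(1, g ^ n) / n`. -/
noncomputable def stableLength {G : Type*} [Group G] (d : PseudoMetricSpace G) (g : G) : ℝ :=
  limUnder atTop fun n : ℕ => d.dist 1 (g ^ n) / n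

/-- The limit that defines the stable translation length exists for a left-invariant `d`. -/
theorem tendsto_stableLength {G : Type*} [Group G] (d : PseudoMetricSpace G)
    (hd : IsLeftInvariant d) (g : G) :
    Tendsto (fun n : ℕ => d.dist 1 (g ^ n) / n) atTop (𝓝 (stableLength d g)) := by
  have hs : Subadditive fun n : ℕ => d.dist 1 (g ^ n) := by
    intro m n
    have h1 := d.dist_triangle 1 (g ^ m) (g ^ (m + n))
    have h2 := hd (g ^ m) 1 (g ^ n)
    rw [mul_one, ← pow_add] at h2
    rw [h2] at h1
    exact h1
  have hb : BddBelow (range fun n : ℕ => d.dist 1 (g ^ n) / n) := by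
    refine ⟨0, ?_⟩
    rintro _ ⟨n, rfl⟩
    have h0 : (0 : ℝ) ≤ d.dist 1 (g ^ n) := @dist_nonneg G d _ _
    positivity
  exact tendsto_nhds_limUnder ⟨_, hs.tendsto_lim hb⟩

/-! Call `w` good if `w • o` is uniformly close to a transversal point of a geodesic from `o` to
each `w ^ (n + 1) • o`. Coarse additivity then telescopes along the powers of `w`, so `d.dist 1 w`
equals the stable length of `w` up to a constant independent of `w` (`abs_stableLength_sub_le`).
Equal spectra therefore make `d₁` and `d₂` uniformly close on good elements.

It remains to make every `g` good at bounded cost (`exists_extension`). A point projects far from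
`o` on at most one of the three axes, so on some axis `Y` both `g • o` and `g⁻¹ • o` project near
`o`. For a fixed long translation `f` along `Y`, the path through the points `(g * f) ^ n • o`
alternates between jumps by `g` and long stretches of translated axes. The contracting property
forces geodesics to follow these stretches, so `w = g * f` is good. Only three elements `f` occur,
and passing from `g` to `g * f` changes each metric by a bounded amount.

This needs `g` to move `o` far; the other elements have bounded `d.dist 1 g`
(`IsCoarselyAdditive.exists_dist_le`). -/

/-! ### Closest points -/

section ClosestPoints

variable {X : Type*} [MetricSpace X] {C : ℝ} {Y : Set X}

theorem mem_cthickening_iff_infDist_le (hY : Y.Nonempty) (hC : 0 ≤ C) {x : X} :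
    x ∈ Metric.cthickening C Y ↔ Metric.infDist x Y ≤ C := by
  rw [Metric.mem_cthickening_iff, Metric.infDist,
    ENNReal.le_ofReal_iff_toReal_le (Metric.infEDist_ne_top hY) hC]

theorem mem_closestPoints_self {x : X} (hx : x ∈ closure Y) : x ∈ closestPoints Y x :=
  ⟨hx, by rw [dist_self, Metric.infDist_zero_of_mem_closure hx]⟩

theorem eq_of_mem_closestPoints {x u : X} (hx : x ∈ closure Y) (hu : u ∈ closestPoints Y x) :
    x = u := by
  have h := hu.2
  rw [Metric.infDist_zero_of_mem_closure hx] at h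
  exact dist_eq_zero.1 h

theorem smul_mem_closestPoints {G : Type*} [Group G] [MulAction G X] [IsIsometricSMul G X]
    (g : G) {x u : X} (hu : u ∈ closestPoints Y x) :
    g • u ∈ closestPoints (g • Y) (g • x) := by
  refine ⟨?_, ?_⟩
  · rw [closure_smul]
    exact smul_mem_smul_set hu.1
  · rw [dist_smul, hu.2]
    exact (Metric.infDist_image (isometry_smul X g)).symm

theorem nonempty_closestPoints_smul {G : Type*} [Group G] [MulAction G X] [IsIsometricSMul G X]
    (g : G) (hp : ∀ x, (closestPoints Y x).Nonempty) (x : X) :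
    (closestPoints (g • Y) x).Nonempty := by
  obtain ⟨u, hu⟩ := hp (g⁻¹ • x)
  refine ⟨g • u, ?_⟩
  simpa using smul_mem_closestPoints g hu

theorem smul_mem_closestPoints_iff {G : Type*} [Group G] [MulAction G X] [IsIsometricSMul G X]
    (g : G) {x u : X} :
    u ∈ closestPoints (g • Y) x ↔ g⁻¹ • u ∈ closestPoints Y (g⁻¹ • x) := by
  refine ⟨fun hu => ?_, fun hu => ?_⟩
  · simpa using smul_mem_closestPoints g⁻¹ hu
  · simpa using smul_mem_closestPoints g hu

end ClosestPoints

/-! ### Geodesic segments and contracting sets -/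

section Contracting

variable {X : Type*} [MetricSpace X] {C : ℝ} {Y : Set X} {γ : ℝ → X} {ℓ : ℝ}

theorem IsGeodesicSegment.reverse (hγ : IsGeodesicSegment γ ℓ) :
    IsGeodesicSegment (fun t => γ (ℓ - t)) ℓ := by
  refine ⟨hγ.length_nonneg, fun s hs t ht => ?_⟩
  rw [hγ.dist_eq _ ⟨by linarith [hs.2], by linarith [hs.1]⟩ _
    ⟨by linarith [ht.2], by linarith [ht.1]⟩, abs_sub_comm]
  congr 1
  ring

theorem IsGeodesicSegment.dist_eq_sub (hγ : IsGeodesicSegment γ ℓ) {s t : ℝ} (hs : 0 ≤ s)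
    (hst : s ≤ t) (ht : t ≤ ℓ) : dist (γ s) (γ t) = t - s := by
  rw [hγ.dist_eq s ⟨hs, hst.trans ht⟩ t ⟨hs.trans hst, ht⟩, abs_sub_comm,
    abs_of_nonneg (sub_nonneg.2 hst)]

theorem IsGeodesicSegment.continuousOn (hγ : IsGeodesicSegment γ ℓ) :
    ContinuousOn γ (Icc 0 ℓ) := by
  refine LipschitzOnWith.continuousOn (K := 1) (LipschitzOnWith.of_dist_le_mul ?_)
  intro s hs t ht
  rw [hγ.dist_eq s hs t ht, Real.dist_eq]
  simp

theorem IsGeodesicSegment.isCompact_inter_cthickening (hγ : IsGeodesicSegment γ ℓ) :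
    IsCompact {s | s ∈ Icc 0 ℓ ∧ γ s ∈ Metric.cthickening C Y} :=
  isCompact_Icc.of_isClosed_subset
    (hγ.continuousOn.preimage_isClosed_of_isClosed isClosed_Icc Metric.isClosed_cthickening)
    fun _ hs => hs.1

theorem IsContractingSet.exists_mem_cthickening (hY : IsContractingSet C Y)
    (hγ : IsGeodesicSegment γ ℓ) {u v : X} (hu : u ∈ closestPoints Y (γ 0))
    (hv : v ∈ closestPoints Y (γ ℓ)) (huv : C < dist u v) :
    {s | s ∈ Icc 0 ℓ ∧ γ s ∈ Metric.cthickening C Y}.Nonempty := by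
  by_contra hne
  refine huv.not_ge (hY.dist_le γ ℓ hγ (fun t ht => ?_) 0 ⟨le_rfl, hγ.length_nonneg⟩ ℓ
    ⟨hγ.length_nonneg, le_rfl⟩ u hu v hv)
  by_contra hlt
  exact hne ⟨t, ht, (mem_cthickening_iff_infDist_le (closure_nonempty_iff.1 ⟨u, hu.1⟩)
    hY.const_nonneg).2 (not_le.1 hlt).le⟩

/-- Before its entry point the geodesic stays outside the `C`-neighbourhood, so its projection moves
by at most `C`; the entry point is itself within `C` of `Y`. -/
theorem IsContractingSet.dist_entry_le (hY : IsContractingSet C Y)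
    (hp : ∀ x, (closestPoints Y x).Nonempty) (hγ : IsGeodesicSegment γ ℓ) {s : ℝ}
    (hs : IsLeast {s | s ∈ Icc 0 ℓ ∧ γ s ∈ Metric.cthickening C Y} s) {u : X}
    (hu : u ∈ closestPoints Y (γ 0)) : dist (γ s) u ≤ 2 * C := by
  have hC := hY.const_nonneg
  have hne : Y.Nonempty := closure_nonempty_iff.1 ⟨u, hu.1⟩
  obtain ⟨⟨⟨hs0, hsl⟩, hsC⟩, hmin⟩ := hs
  rw [mem_cthickening_iff_infDist_le hne hC] at hsC
  rcases hs0.eq_or_lt with rfl | hpos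
  · rw [hu.2]
    linarith
  · obtain ⟨q, hq⟩ := hp (γ s)
    have hfar : ∀ t ∈ Icc 0 s, C ≤ Metric.infDist (γ t) Y := by
      intro t ht
      by_contra hlt
      rw [not_le] at hlt
      have hr0 : 0 ≤ max 0 (t - (C - Metric.infDist (γ t) Y)) := le_max_left _ _
      have hrt : max 0 (t - (C - Metric.infDist (γ t) Y)) ≤ t := max_le ht.1 (by linarith)
      -- Going back from `t` by the slack `C - infDist` stays in the neighbourhood, since `infDist`
      -- is 1-Lipschitz; this contradicts the minimality of `s`, even when `t = s`.
      have hrt' := le_max_right 0 (t - (C - Metric.infDist (γ t) Y))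
      have hlt' : max 0 (t - (C - Metric.infDist (γ t) Y)) < s :=
        max_lt hpos (by linarith [ht.2])
      set r := max 0 (t - (C - Metric.infDist (γ t) Y))
      have h1 : Metric.infDist (γ r) Y ≤ Metric.infDist (γ t) Y + dist (γ r) (γ t) :=
        Metric.infDist_le_infDist_add_dist
      rw [hγ.dist_eq_sub hr0 hrt (ht.2.trans hsl)] at h1
      have h2 : s ≤ r := hmin ⟨⟨hr0, hlt'.le.trans hsl⟩,
        (mem_cthickening_iff_infDist_le hne hC).2 (by linarith)⟩
      linarith
    have hγs : IsGeodesicSegment γ s :=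
      ⟨hs0, fun a ha b hb => hγ.dist_eq a ⟨ha.1, ha.2.trans hsl⟩ b ⟨hb.1, hb.2.trans hsl⟩⟩
    have h1 := hY.dist_le γ s hγs hfar s ⟨hs0, le_rfl⟩ 0 ⟨le_rfl, hs0⟩ q hq u hu
    have h2 := dist_triangle (γ s) q u
    have h3 := hq.2
    linarith

theorem IsContractingSet.dist_exit_le (hY : IsContractingSet C Y)
    (hp : ∀ x, (closestPoints Y x).Nonempty) (hγ : IsGeodesicSegment γ ℓ) {t : ℝ}
    (ht : IsGreatest {s | s ∈ Icc 0 ℓ ∧ γ s ∈ Metric.cthickening C Y} t) {v : X}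
    (hv : v ∈ closestPoints Y (γ ℓ)) : dist (γ t) v ≤ 2 * C := by
  have h : dist (γ (ℓ - (ℓ - t))) v ≤ 2 * C := by
    refine hY.dist_entry_le hp hγ.reverse (s := ℓ - t) ⟨⟨⟨?_, ?_⟩, ?_⟩, ?_⟩ (by simpa using hv)
    · linarith [ht.1.1.2]
    · linarith [ht.1.1.1]
    · simpa using ht.1.2
    · intro r hr
      have : ℓ - r ≤ t := ht.2 ⟨⟨by linarith [hr.1.2], by linarith [hr.1.1]⟩, hr.2⟩
      linarith
  simpa using h

theorem IsContractingSet.exists_entry_exit (hY : IsContractingSet C Y)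
    (hp : ∀ x, (closestPoints Y x).Nonempty) (hγ : IsGeodesicSegment γ ℓ) {u v : X}
    (hu : u ∈ closestPoints Y (γ 0)) (hv : v ∈ closestPoints Y (γ ℓ)) (huv : C < dist u v) :
    ∃ s t, IsLeast {s | s ∈ Icc 0 ℓ ∧ γ s ∈ Metric.cthickening C Y} s ∧
      IsGreatest {s | s ∈ Icc 0 ℓ ∧ γ s ∈ Metric.cthickening C Y} t ∧ s ≤ t ∧
      dist (γ s) u ≤ 2 * C ∧ dist (γ t) v ≤ 2 * C := by
  have hne := hY.exists_mem_cthickening hγ hu hv huv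
  obtain ⟨s, hs⟩ := hγ.isCompact_inter_cthickening.exists_isLeast hne
  obtain ⟨t, ht⟩ := hγ.isCompact_inter_cthickening.exists_isGreatest hne
  exact ⟨s, t, hs, ht, hs.2 ht.1, hY.dist_entry_le hp hγ hs hu, hY.dist_exit_le hp hγ ht hv⟩

theorem dist_sub_le_diam_inter_cthickening (hγ : IsGeodesicSegment γ ℓ) {s t : ℝ}
    (hs : s ∈ {s | s ∈ Icc 0 ℓ ∧ γ s ∈ Metric.cthickening C Y})
    (ht : t ∈ {s | s ∈ Icc 0 ℓ ∧ γ s ∈ Metric.cthickening C Y}) :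
    dist (γ s) (γ t) ≤ Metric.diam (γ '' Icc 0 ℓ ∩ Metric.cthickening C Y) :=
  Metric.dist_le_diam_of_mem
    ((isCompact_Icc.image_of_continuousOn hγ.continuousOn).isBounded.subset inter_subset_left)
    ⟨mem_image_of_mem γ hs.1, hs.2⟩ ⟨mem_image_of_mem γ ht.1, ht.2⟩

/-- The geodesic passes within `2 * C` of `u` and then of `v`; each of these points is used twice,
whence `8 * C`. -/
theorem IsContractingSet.le_dist (hX : IsGeodesicSpace X) (hY : IsContractingSet C Y)
    (hp : ∀ x, (closestPoints Y x).Nonempty) {x y u v : X}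
    (hu : u ∈ closestPoints Y x) (hv : v ∈ closestPoints Y y) (huv : C < dist u v) :
    dist x u + dist u v + dist v y - 8 * C ≤ dist x y := by
  obtain ⟨γ, ℓ, hγ, rfl, rfl⟩ := hX x y
  obtain ⟨s, t, hs, ht, hst, h1, h2⟩ := hY.exists_entry_exit hp hγ hu hv huv
  have e1 := hγ.dist_eq_sub le_rfl hγ.length_nonneg le_rfl
  have e2 := hγ.dist_eq_sub le_rfl hs.1.1.1 hs.1.1.2
  have e3 := hγ.dist_eq_sub hs.1.1.1 hst ht.1.1.2
  have e4 := hγ.dist_eq_sub ht.1.1.1 ht.1.1.2 le_rfl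
  have t1 := dist_triangle (γ 0) (γ s) u
  have t2 := dist_triangle4 u (γ s) (γ t) v
  have t3 := dist_triangle v (γ t) (γ ℓ)
  rw [dist_comm u (γ s)] at t2
  rw [dist_comm v (γ t)] at t3
  linarith

theorem IsContractingSet.dist_closestPoints_le (hX : IsGeodesicSpace X)
    (hY : IsContractingSet C Y) (hp : ∀ x, (closestPoints Y x).Nonempty) {x y u v : X}
    (hu : u ∈ closestPoints Y x) (hv : v ∈ closestPoints Y y) :
    dist u v ≤ dist x y + 8 * C := by
  have hC := hY.const_nonneg
  rcases le_or_gt (dist u v) C with h | h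
  · linarith [dist_nonneg (x := x) (y := y)]
  · linarith [hY.le_dist hX hp hu hv h, dist_nonneg (x := x) (y := u),
      dist_nonneg (x := v) (y := y)]

theorem IsContractingSet.le_dist_of_closestPoints (hX : IsGeodesicSpace X)
    (hY : IsContractingSet C Y) (hp : ∀ x, (closestPoints Y x).Nonempty) {x y u v : X}
    (hu : u ∈ closestPoints Y x) (hv : v ∈ closestPoints Y y) :
    dist x v + dist v y - 8 * C - 2 * dist x u ≤ dist x y := by
  have hC := hY.const_nonneg
  have t1 := dist_triangle x u v
  rcases le_or_gt (dist u v) C with h | h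
  · have t2 := dist_triangle_left v y x
    linarith
  · linarith [hY.le_dist hX hp hu hv h, dist_nonneg (x := x) (y := u)]

/-- Quasi-convexity of contracting sets. -/
theorem IsContractingSet.infDist_le_of_between (hX : IsGeodesicSpace X)
    (hY : IsContractingSet C Y) (hp : ∀ x, (closestPoints Y x).Nonempty) {x p y : X}
    (hxy : dist x p + dist p y = dist x y) :
    Metric.infDist p Y ≤ 8 * C + Metric.infDist x Y + Metric.infDist y Y := by
  obtain ⟨u, hu⟩ := hp x
  obtain ⟨v, hv⟩ := hp y
  obtain ⟨w, hw⟩ := hp p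
  -- Adding the two bounds shows that the detour through `w` costs about `2 * dist p w`, while `p`
  -- itself costs nothing.
  have h1 := hY.le_dist_of_closestPoints hX hp hu hw
  have h2 := hY.le_dist_of_closestPoints hX hp hv hw
  have t := dist_triangle x w y
  rw [dist_comm y w, dist_comm y p] at h2
  rw [← hu.2, ← hv.2, ← hw.2]
  rw [dist_comm w p] at h1 h2
  linarith

/-- A point cannot have closest points far from `o` on both of two contracting sets through `o`
with bounded intersection. -/
theorem dist_closestPoints_le_or_of_hasBoundedIntersection (hX : IsGeodesicSpace X) {Z : Set X}
    (hY : IsContractingSet C Y) (hZ : IsContractingSet C Z)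
    (hYp : ∀ x, (closestPoints Y x).Nonempty) (hZp : ∀ x, (closestPoints Z x).Nonempty)
    (hYZ : HasBoundedIntersection Y Z) {o : X} (hoY : o ∈ Y) (hoZ : o ∈ Z) :
    ∃ τ : ℝ, ∀ x : X, (∀ u ∈ closestPoints Y x, dist u o ≤ τ) ∨
      (∀ v ∈ closestPoints Z x, dist v o ≤ τ) := by
  obtain ⟨ρ, hρ⟩ := hYZ
  have hC := hY.const_nonneg
  have ho : ∀ {W : Set X}, o ∈ W → o ∈ Metric.cthickening (9 * C) W := fun h =>
    Metric.self_subset_cthickening _ h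
  have key : ∀ (p : X), Metric.infDist p Y ≤ 9 * C → Metric.infDist p Z ≤ 9 * C →
      dist p o ≤ ρ (9 * C) := fun p h1 h2 =>
    hρ (9 * C) (by positivity) p
      ⟨(mem_cthickening_iff_infDist_le ⟨o, hoY⟩ (by positivity)).2 h1,
        (mem_cthickening_iff_infDist_le ⟨o, hoZ⟩ (by positivity)).2 h2⟩
      o ⟨ho hoY, ho hoZ⟩
  have hρ0 : 0 ≤ ρ (9 * C) := by
    have := hρ (9 * C) (by positivity) o ⟨ho hoY, ho hoZ⟩ o ⟨ho hoY, ho hoZ⟩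
    simpa using this
  refine ⟨ρ (9 * C) + 2 * C, fun x => ?_⟩
  by_contra! hcon
  obtain ⟨⟨u, hu, huo⟩, v, hv, hvo⟩ := hcon
  obtain ⟨γ, ℓ, hγ, h0, rfl⟩ := hX o x
  obtain ⟨_, s, -, hs, -, -, hsu⟩ := hY.exists_entry_exit hYp hγ
    (mem_closestPoints_self (by rw [h0]; exact subset_closure hoY)) hu
    (by rw [h0, dist_comm]; linarith)
  obtain ⟨_, t, -, ht, -, -, htv⟩ := hZ.exists_entry_exit hZp hγ
    (mem_closestPoints_self (by rw [h0]; exact subset_closure hoZ)) hv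
    (by rw [h0, dist_comm]; linarith)
  have hsY := (mem_cthickening_iff_infDist_le ⟨o, hoY⟩ hC).1 hs.1.2
  have htZ := (mem_cthickening_iff_infDist_le ⟨o, hoZ⟩ hC).1 ht.1.2
  have h0Y : Metric.infDist (γ 0) Y = 0 := by rw [h0, Metric.infDist_zero_of_mem hoY]
  have h0Z : Metric.infDist (γ 0) Z = 0 := by rw [h0, Metric.infDist_zero_of_mem hoZ]
  have between : ∀ {a b : ℝ}, 0 ≤ a → a ≤ b → b ≤ ℓ →
      dist (γ 0) (γ a) + dist (γ a) (γ b) = dist (γ 0) (γ b) := by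
    intro a b h1 h2 h3
    rw [hγ.dist_eq_sub le_rfl h1 (h2.trans h3), hγ.dist_eq_sub h1 h2 h3,
      hγ.dist_eq_sub le_rfl (h1.trans h2) h3]
    ring
  -- The earlier exit point lies between `o` and a point `C`-close to the other set, so by
  -- quasi-convexity it is `9 * C`-close to both sets.
  rcases le_total s t with hst | hst
  · have h1 := hZ.infDist_le_of_between hX hZp (between hs.1.1.1 hst ht.1.1.2)
    have h2 := key (γ s) (by linarith) (by linarith)
    have h3 := dist_triangle_left u o (γ s)
    linarith
  · have h1 := hY.infDist_le_of_between hX hYp (between ht.1.1.1 hst hs.1.1.2)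
    have h2 := key (γ t) (by linarith) (by linarith)
    have h3 := dist_triangle_left v o (γ t)
    linarith

/-- If `b ∈ Z` projects close to `o ∈ Y` and `o` projects close to `b`, with `o` and `b` far apart,
then all of `Z` projects close to `o`. -/
theorem dist_closestPoints_le_of_mutually_close (hX : IsGeodesicSpace X) {Z : Set X}
    (hY : IsContractingSet C Y) (hZ : IsContractingSet C Z)
    (hYp : ∀ x, (closestPoints Y x).Nonempty) (hZp : ∀ x, (closestPoints Z x).Nonempty)
    {o b : X} {τ : ℝ}
    (hbY : ∀ u ∈ closestPoints Y b, dist u o ≤ τ) (hoZ : ∀ v ∈ closestPoints Z o, dist v b ≤ τ)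
    (hfar : 2 * τ + 8 * C < dist o b) {a u : X} (ha : a ∈ closure Z)
    (hu : u ∈ closestPoints Y a) : dist u o ≤ 9 * C + 2 * τ := by
  have hC := hY.const_nonneg
  obtain ⟨u₀, hu₀⟩ := hYp b
  obtain ⟨u₁, hu₁⟩ := hZp o
  have hτ₀ := hbY u₀ hu₀
  have hτ₁ := hoZ u₁ hu₁
  have hLip := hY.dist_closestPoints_le hX hYp hu hu₀
  -- Otherwise the way from `a` to `b` passes near `o`, so `dist a o < dist a b`. By the Lipschitz
  -- bound `a` is also far from `u₁`, so the way from `a` to `o` passes near `b`, which gives the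
  -- reverse inequality.
  by_contra! hbig
  have t1 := dist_triangle u u₀ o
  have h1 := hY.le_dist hX hYp hu hu₀ (by linarith [dist_nonneg.trans hτ₀])
  have t2 := dist_triangle4 a u u₀ o
  have t3 := dist_triangle_left o b u₀
  have t4 := dist_triangle a u₁ b
  have h2 : C < dist a u₁ := by linarith
  have h3 := hZ.le_dist hX hZp (mem_closestPoints_self ha) hu₁ h2
  rw [dist_self] at h3
  have t5 := dist_triangle_left o b u₁
  have t6 := dist_comm a o
  linarith

end Contracting

/-! ### Axes -/

section Axes

variable {G X : Type*} [Group G] [MulAction G X] {f : G} {o : X}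

theorem mem_cyclicOrbit_self (f : G) (o : X) : o ∈ cyclicOrbit f o := ⟨0, by simp⟩

theorem zpow_smul_cyclicOrbit (f : G) (o : X) (n : ℤ) :
    f ^ n • cyclicOrbit f o = cyclicOrbit f o := by
  ext x
  rw [mem_smul_set_iff_inv_smul_mem]
  constructor
  · rintro ⟨m, hm⟩
    exact ⟨n + m, by simp only at hm ⊢; rw [zpow_add, mul_smul, hm, smul_inv_smul]⟩
  · rintro ⟨m, rfl⟩
    exact ⟨-n + m, by simp only; rw [zpow_add, mul_smul, zpow_neg]⟩

theorem smul_cyclicOrbit_mem_axisSystem {ι : Type*} {h : ι → G} (g : G) (i : ι) :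
    g • cyclicOrbit (h i) o ∈ axisSystem h o := ⟨g, i, rfl⟩

theorem cyclicOrbit_mem_axisSystem {ι : Type*} {h : ι → G} (i : ι) :
    cyclicOrbit (h i) o ∈ axisSystem h o :=
  ⟨1, i, (one_smul _ _).symm⟩

theorem IsContractingElement.exists_lt_dist_pow [MetricSpace X] (hf : IsContractingElement f o)
    (T : ℝ) :
    ∃ n : ℕ, T < dist o (f ^ n • o) := by
  obtain ⟨a, c, ha, hc, h⟩ := hf.quasiIsometric
  obtain ⟨n, hn⟩ := exists_nat_gt (a * (T + c))
  refine ⟨n, ?_⟩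
  have h1 := (h 0 n).1
  have ha0 : 0 < a := by linarith
  have h2 : T + c < a⁻¹ * n := by rwa [inv_mul_eq_div, lt_div_iff₀' ha0]
  simp only [Int.cast_zero, zero_sub, abs_neg, zpow_zero, one_smul, zpow_natCast,
    Int.cast_natCast, Nat.abs_cast] at h1
  linarith

/-- The quasi-isometric embedding makes the distances to orbit points tend to infinity, so a minimum
is attained. -/
theorem IsContractingElement.nonempty_closestPoints [MetricSpace X]
    (hf : IsContractingElement f o) (x : X) :
    (closestPoints (cyclicOrbit f o) x).Nonempty := by
  obtain ⟨a, c, ha, hc, h⟩ := hf.quasiIsometric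
  have ha0 : 0 < a := by linarith
  have htend : Tendsto (fun n : ℤ => dist x (f ^ n • o)) cofinite atTop := by
    have h1 : Tendsto (fun n : ℤ => a⁻¹ * |(n : ℝ)| + (-c - dist x o)) cofinite atTop := by
      refine tendsto_atTop_add_const_right _ _ (Tendsto.const_mul_atTop (inv_pos.2 ha0) ?_)
      have := tendsto_norm_cocompact_atTop.comp Int.tendsto_coe_cofinite
      exact this
    refine tendsto_atTop_mono (fun n => ?_) h1
    have h2 := (h n 0).1
    have h3 := dist_triangle_left (f ^ n • o) o x
    simp only [Int.cast_zero, sub_zero, zpow_zero, one_smul] at h2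
    linarith
  obtain ⟨n, hn⟩ := htend.exists_forall_le
  refine ⟨f ^ n • o, subset_closure ⟨n, rfl⟩, le_antisymm ?_ ?_⟩
  · rw [Metric.le_infDist ⟨o, mem_cyclicOrbit_self f o⟩]
    rintro _ ⟨m, rfl⟩
    exact hn m
  · exact Metric.infDist_le_dist_of_mem ⟨n, rfl⟩

end Axes

/-! ### Concatenating along axes -/

section Extension

variable {G X : Type*} [Group G] [MetricSpace X] [MulAction G X] [IsIsometricSMul G X]
  {C τ L : ℝ} {Y : Set X} {f g : G} {o : X}

theorem dist_closestPoints_smul_le (hτ : ∀ u ∈ closestPoints Y (g⁻¹ • o), dist u o ≤ τ) :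
    ∀ v ∈ closestPoints (g • Y) o, dist v (g • o) ≤ τ := by
  intro v hv
  rw [← dist_smul g⁻¹, inv_smul_smul]
  exact hτ _ ((smul_mem_closestPoints_iff g).1 hv)

theorem mul_smul_mem_closestPoints (hf : f • Y = Y) {x v : X} (hv : v ∈ closestPoints Y x) :
    (g * f) • v ∈ closestPoints (g • Y) ((g * f) • x) := by
  have h := smul_mem_closestPoints (g * f) hv
  rwa [mul_smul g f Y, hf] at h

theorem le_dist_mul_smul {B u v : ℝ} {p q : X} (hp : dist p o ≤ u)
    (hq : dist q (g • o) ≤ v) (hB : B < dist o (f • o)) :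
    B - u - v < dist ((g * f) • p) q := by
  have h1 : dist ((g * f) • p) ((g * f) • o) ≤ u := by rwa [dist_smul]
  have h2 : dist (g • o) ((g * f) • o) = dist o (f • o) := by rw [mul_smul, dist_smul]
  have h3 := dist_triangle4 (g • o) q ((g * f) • p) ((g * f) • o)
  rw [dist_comm (g • o) q, dist_comm q ((g * f) • p)] at h3
  linarith

/-- If the axis `Y` is shallow with respect to `g • o` and `g⁻¹ • o` and the translation `f` along
`Y` is long, then every power of `g * f` moves `o` to a point that projects close to `o`. -/
theorem dist_closestPoints_pow_le (hX : IsGeodesicSpace X)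
    (hY : IsContractingSet C Y) (hgY : IsContractingSet C (g • Y))
    (hYp : ∀ x, (closestPoints Y x).Nonempty) (hoY : o ∈ Y) (hfY : f • Y = Y)
    (hτ : ∀ u ∈ closestPoints Y (g • o), dist u o ≤ τ)
    (hτ' : ∀ u ∈ closestPoints Y (g⁻¹ • o), dist u o ≤ τ)
    (hg : 2 * τ + 8 * C < dist o (g • o)) (hf : 44 * C + 7 * τ < dist o (f • o)) (n : ℕ) :
    ∀ u ∈ closestPoints Y ((g * f) ^ n • o), dist u o ≤ 10 * C + 2 * τ := by
  have hC := hY.const_nonneg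
  have hτ0 : 0 ≤ τ := by
    obtain ⟨u, hu⟩ := hYp (g • o)
    exact dist_nonneg.trans (hτ u hu)
  have hgYp := nonempty_closestPoints_smul g hYp
  have hoZ := dist_closestPoints_smul_le hτ'
  induction n with
  | zero =>
    intro u hu
    rw [pow_zero, one_smul] at hu
    rw [← eq_of_mem_closestPoints (subset_closure hoY) hu, dist_self]
    positivity
  | succ n ih =>
    intro u hu
    obtain ⟨v', hv'⟩ := hYp ((g * f) ^ n • o)
    obtain ⟨u₁, hu₁⟩ := hgYp o
    have hv := mul_smul_mem_closestPoints (g := g) hfY hv'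
    rw [← mul_smul, ← pow_succ'] at hv
    have h1 := le_dist_mul_smul (ih v' hv') (hoZ u₁ hu₁) hf
    set v := (g * f) • v'
    set x := (g * f) ^ (n + 1) • o
    obtain ⟨u', hu'⟩ := hYp v
    have hu'o := dist_closestPoints_le_of_mutually_close hX hY hgY hYp hgYp hτ hoZ hg hv.1 hu'
    -- The way from `x` to `v` would pass near `o`, whereas that from `x` to `o` passes near `v` and
    -- then `u₁`. Together these give `dist v u₁ ≤ 16 * C + 2 * (9 * C + 2 * τ)`. The threshold `44
    -- * C + 7 * τ` is this bound plus the endpoint errors `10 * C + 2 * τ` and `τ`.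
    by_contra! hbig
    have t1 := dist_triangle u u' o
    have h2 := hY.le_dist hX hYp hu hu' (by linarith)
    have h3 := hgY.le_dist hX hgYp hv hu₁ (by linarith)
    have t2 := dist_triangle4 x u u' o
    have t3 := dist_triangle_left o v u'
    linarith [dist_nonneg (x := o) (y := v), dist_nonneg (x := u₁) (y := o)]

/-- On `g • Y`, the point `o` projects near `g • o` and `(g * f) ^ (n + 1) • o` near `(g * f) • o`;
the transversal point is the exit point from the neighbourhood of `g • Y`. -/
theorem exists_isTransversalPoint_pow (hX : IsGeodesicSpace X)
    (hY : IsContractingSet C Y) (hgY : IsContractingSet C (g • Y))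
    (hYp : ∀ x, (closestPoints Y x).Nonempty) (hoY : o ∈ Y) (hfY : f • Y = Y)
    (hτ : ∀ u ∈ closestPoints Y (g • o), dist u o ≤ τ)
    (hτ' : ∀ u ∈ closestPoints Y (g⁻¹ • o), dist u o ≤ τ) (hL : 0 < L)
    (hg : 2 * τ + 8 * C < dist o (g • o)) (hf : 44 * C + 7 * τ + L < dist o (f • o))
    {𝓕 : Set (Set X)} (h𝓕 : g • Y ∈ 𝓕) (n : ℕ) :
    ∃ (γ : ℝ → X) (ℓ : ℝ), IsGeodesicSegment γ ℓ ∧ γ 0 = o ∧ γ ℓ = (g * f) ^ (n + 1) • o ∧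
      ∃ x, IsTransversalPoint 𝓕 C L γ ℓ x ∧ dist ((g * f) • o) x ≤ 12 * C + 2 * τ := by
  have hC := hY.const_nonneg
  have hτ0 : 0 ≤ τ := by
    obtain ⟨u, hu⟩ := hYp (g • o)
    exact dist_nonneg.trans (hτ u hu)
  have hgYp := nonempty_closestPoints_smul g hYp
  obtain ⟨v, hv⟩ := hYp ((g * f) ^ n • o)
  obtain ⟨u, hu⟩ := hgYp o
  have hvo := dist_closestPoints_pow_le hX hY hgY hYp hoY hfY hτ hτ' hg (by linarith) n v hv
  have h1 := le_dist_mul_smul hvo (dist_closestPoints_smul_le hτ' u hu) hf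
  have hv' := mul_smul_mem_closestPoints (g := g) hfY hv
  rw [← mul_smul, ← pow_succ'] at hv'
  obtain ⟨γ, ℓ, hγ, h0, hℓ⟩ := hX o ((g * f) ^ (n + 1) • o)
  rw [← h0] at hu
  rw [← hℓ] at hv'
  rw [dist_comm] at h1
  obtain ⟨s, t, hs, ht, -, hsu, htv⟩ := hgY.exists_entry_exit hgYp hγ hu hv' (by linarith)
  refine ⟨γ, ℓ, hγ, h0, hℓ, γ t, ⟨g • Y, h𝓕, ?_, t, rfl, Or.inr ht⟩, ?_⟩
  · refine lt_of_lt_of_le ?_ (dist_sub_le_diam_inter_cthickening hγ hs.1 ht.1)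
    have t1 := dist_triangle4 u (γ s) (γ t) ((g * f) • v)
    rw [dist_comm u (γ s)] at t1
    linarith
  · have t1 := dist_triangle_left ((g * f) • o) (γ t) ((g * f) • v)
    rw [dist_smul, dist_comm _ (γ t)] at t1
    rw [dist_comm _ (γ t)]
    rw [dist_comm _ (γ t)] at t1
    linarith

end Extension

/-! ### The three axes -/

section AxisSystem

variable {G X : Type*} [Group G] [MetricSpace X] [MulAction G X] {o : X} {h : Fin 3 → G} {C L : ℝ}

/-- Pigeonhole: each of `x` and `y` excludes at most one of the three axes. -/
theorem exists_axis_close_projections (hX : IsGeodesicSpace X)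
    (hcontr : ∀ i, IsContractingElement (h i) o)
    (hindep : ∀ i j, i ≠ j → WeaklyIndependent (h i) (h j) o)
    (hC : ∀ Z ∈ axisSystem h o, IsContractingSet C Z) :
    ∃ τ : ℝ, ∀ x y : X, ∃ i, (∀ u ∈ closestPoints (cyclicOrbit (h i) o) x, dist u o ≤ τ) ∧
      ∀ u ∈ closestPoints (cyclicOrbit (h i) o) y, dist u o ≤ τ := by
  have hpair := fun (i j : Fin 3) (hij : i ≠ j) =>
    dist_closestPoints_le_or_of_hasBoundedIntersection hX
      (hC _ (cyclicOrbit_mem_axisSystem i)) (hC _ (cyclicOrbit_mem_axisSystem j))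
      (hcontr i).nonempty_closestPoints (hcontr j).nonempty_closestPoints
      (hindep i j hij) (mem_cyclicOrbit_self (h i) o) (mem_cyclicOrbit_self (h j) o)
  obtain ⟨a, ha⟩ := hpair 0 1 (by decide)
  obtain ⟨b, hb⟩ := hpair 0 2 (by decide)
  obtain ⟨c, hc⟩ := hpair 1 2 (by decide)
  have mono : ∀ (x : X) (i : Fin 3) (s : ℝ), s ≤ max a (max b c) →
      (∀ u ∈ closestPoints (cyclicOrbit (h i) o) x, dist u o ≤ s) →
      ∀ u ∈ closestPoints (cyclicOrbit (h i) o) x, dist u o ≤ max a (max b c) :=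
    fun x i s hs H u hu => (H u hu).trans hs
  have hma : a ≤ max a (max b c) := le_max_left _ _
  have hmb : b ≤ max a (max b c) := (le_max_left _ _).trans (le_max_right _ _)
  have hmc : c ≤ max a (max b c) := (le_max_right _ _).trans (le_max_right _ _)
  have h01 := fun x => (ha x).imp (mono x 0 a hma) (mono x 1 a hma)
  have h02 := fun x => (hb x).imp (mono x 0 b hmb) (mono x 2 b hmb)
  have h12 := fun x => (hc x).imp (mono x 1 c hmc) (mono x 2 c hmc)
  refine ⟨max a (max b c), fun x y => ?_⟩
  rcases h01 x, h01 y, h02 x, h02 y, h12 x, h12 y with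
    ⟨x01 | x01, y01 | y01, x02 | x02, y02 | y02, x12 | x12, y12 | y12⟩
  all_goals first | exact ⟨0, ‹_›, ‹_›⟩ | exact ⟨1, ‹_›, ‹_›⟩ | exact ⟨2, ‹_›, ‹_›⟩

/-- Extension to elements whose iterates have transversal points: there are three elements such
that each `g` moving `o` far becomes, after right multiplication by one of them, an element `w`
whose orbit point `w • o` is close to a transversal point of a geodesic from `o` to each
`w ^ (n + 1) • o`. -/
theorem exists_extension [IsIsometricSMul G X] (hX : IsGeodesicSpace X)
    (hcontr : ∀ i, IsContractingElement (h i) o)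
    (hindep : ∀ i j, i ≠ j → WeaklyIndependent (h i) (h j) o)
    (hC : ∀ Z ∈ axisSystem h o, IsContractingSet C Z) (hL : 0 < L) :
    ∃ (f : Fin 3 → G) (D r : ℝ), 0 < r ∧ ∀ g : G, D < dist o (g • o) → ∃ i, ∀ n : ℕ,
      ∃ (γ : ℝ → X) (ℓ : ℝ), IsGeodesicSegment γ ℓ ∧ γ 0 = o ∧
        γ ℓ = (g * f i) ^ (n + 1) • o ∧
        ∃ x, IsTransversalPoint (axisSystem h o) C L γ ℓ x ∧ dist ((g * f i) • o) x ≤ r := by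
  obtain ⟨τ, hτ⟩ := exists_axis_close_projections hX hcontr hindep hC
  choose N hN using fun i => (hcontr i).exists_lt_dist_pow (44 * C + 7 * τ + L)
  -- The maximum with `1` is there because coarse additivity asks for `0 < r`.
  refine ⟨fun i => h i ^ N i, 2 * τ + 8 * C, max 1 (12 * C + 2 * τ),
    lt_max_of_lt_left one_pos, fun g hg => ?_⟩
  obtain ⟨i, hi, hi'⟩ := hτ (g • o) (g⁻¹ • o)
  refine ⟨i, fun n => ?_⟩
  obtain ⟨γ, ℓ, hγ, h0, hℓ, x, hx, hxr⟩ := exists_isTransversalPoint_pow hX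
    (hC _ (cyclicOrbit_mem_axisSystem i)) (hC _ (smul_cyclicOrbit_mem_axisSystem g i))
    (hcontr i).nonempty_closestPoints (mem_cyclicOrbit_self (h i) o)
    (f := h i ^ N i) (by simpa using zpow_smul_cyclicOrbit (h i) o (N i)) hi hi' hL hg (hN i)
    (smul_cyclicOrbit_mem_axisSystem g i) n
  exact ⟨γ, ℓ, hγ, h0, hℓ, x, hx, hxr.trans (le_max_right _ _)⟩

theorem exists_isTransversalPoint_basepoint (hX : IsGeodesicSpace X)
    (hcontr : ∀ i, IsContractingElement (h i) o) :
    ∃ (k : G) (γ : ℝ → X) (ℓ : ℝ), IsGeodesicSegment γ ℓ ∧ γ 0 = o ∧ γ ℓ = k • o ∧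
      IsTransversalPoint (axisSystem h o) C L γ ℓ o := by
  obtain ⟨N, hN⟩ := (hcontr 0).exists_lt_dist_pow L
  obtain ⟨γ, ℓ, hγ, h0, hℓ⟩ := hX o (h 0 ^ N • o)
  have mem0 : (0 : ℝ) ∈ {s | s ∈ Icc 0 ℓ ∧ γ s ∈ Metric.cthickening C (cyclicOrbit (h 0) o)} := by
    refine ⟨⟨le_rfl, hγ.length_nonneg⟩, Metric.self_subset_cthickening _ ?_⟩
    rw [h0]
    exact mem_cyclicOrbit_self _ _
  have meml : ℓ ∈ {s | s ∈ Icc 0 ℓ ∧ γ s ∈ Metric.cthickening C (cyclicOrbit (h 0) o)} := by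
    refine ⟨⟨hγ.length_nonneg, le_rfl⟩, Metric.self_subset_cthickening _ ?_⟩
    rw [hℓ]
    exact ⟨N, by simp⟩
  refine ⟨h 0 ^ N, γ, ℓ, hγ, h0, hℓ, _, cyclicOrbit_mem_axisSystem 0, ?_, 0, h0.symm,
    Or.inl ⟨mem0, fun s hs => hs.1.1⟩⟩
  have := dist_sub_le_diam_inter_cthickening hγ mem0 meml
  rw [h0, hℓ] at this
  exact hN.trans_le this

end AxisSystem

/-! ### Coarsely additive metrics -/

section CoarselyAdditive

variable {G X : Type*} [Group G] {d : PseudoMetricSpace G}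

/-- By left-invariance each further power adds `d.dist 1 w` up to `B`; divide the sum by `n`. -/
theorem abs_stableLength_sub_le (hd : IsLeftInvariant d) {w : G} {B : ℝ}
    (hB : ∀ n : ℕ, |d.dist 1 (w ^ (n + 1)) - d.dist 1 w - d.dist w (w ^ (n + 1))| ≤ B) :
    |stableLength d w - d.dist 1 w| ≤ B := by
  have key : ∀ n : ℕ, |d.dist 1 (w ^ n) - n * d.dist 1 w| ≤ n * B := by
    intro n
    induction n with
    | zero =>
      simp
    | succ n ih =>
      have h1 := hB n
      have h2 := hd w 1 (w ^ n)
      rw [mul_one, ← pow_succ'] at h2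
      rw [h2] at h1
      rw [abs_le] at ih h1 ⊢
      push_cast
      constructor <;> linarith [ih.1, ih.2, h1.1, h1.2]
  refine le_of_tendsto ((tendsto_stableLength d hd w).sub_const (d.dist 1 w)).abs ?_
  filter_upwards [eventually_gt_atTop 0] with n hn
  have hn' : (0 : ℝ) < n := by exact_mod_cast hn
  have h1 : d.dist 1 (w ^ n) / n - d.dist 1 w = (d.dist 1 (w ^ n) - n * d.dist 1 w) / n := by
    field_simp
  rw [h1, abs_div, abs_of_pos hn', div_le_iff₀ hn', mul_comm B]
  exact key n

variable [MetricSpace X] [MulAction G X] {o : X} {h : Fin 3 → G} {C L : ℝ}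

/-- With `o` a transversal point of one fixed geodesic from `o` to `k • o`, additivity at `g` bounds
`d.dist 1 g + d.dist g k`. -/
theorem IsCoarselyAdditive.exists_dist_le (hX : IsGeodesicSpace X)
    (hcontr : ∀ i, IsContractingElement (h i) o)
    (hadd : IsCoarselyAdditive d o (axisSystem h o) C L) (D : ℝ) :
    ∃ B, ∀ g : G, dist o (g • o) ≤ D → d.dist 1 g ≤ B := by
  obtain ⟨R, hR⟩ := hadd
  obtain ⟨k, γ, ℓ, hγ, h0, hℓ, ho⟩ :=
    exists_isTransversalPoint_basepoint (C := C) (L := L) hX hcontr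
  refine ⟨d.dist 1 k + R (max 1 D), fun g hg => ?_⟩
  have h1 := hR (max 1 D) (lt_max_of_lt_left one_pos) 1 g k γ ℓ hγ (by rw [h0, one_smul]) hℓ
    ⟨o, ho, by rw [dist_comm]; exact hg.trans (le_max_right _ _)⟩
  have h2 : 0 ≤ d.dist g k := @dist_nonneg G d g k
  linarith [(abs_le.1 h1).1]

end CoarselyAdditive

theorem mainTheorem5 {G X : Type*} [Group G] [MetricSpace X] [MulAction G X]
    [IsIsometricSMul G X] (hX : IsGeodesicSpace X) (o : X)
    (h : Fin 3 → G) (hcontr : ∀ i, IsContractingElement (h i) o)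
    (hindep : ∀ i j, i ≠ j → WeaklyIndependent (h i) (h j) o)
    (C : ℝ) (hC : ∀ Z ∈ axisSystem h o, IsContractingSet C Z)
    (d₁ d₂ : PseudoMetricSpace G) (hd₁ : IsLeftInvariant d₁) (hd₂ : IsLeftInvariant d₂)
    (L : ℝ) (hL : 0 < L)
    (hadd₁ : IsCoarselyAdditive d₁ o (axisSystem h o) C L)
    (hadd₂ : IsCoarselyAdditive d₂ o (axisSystem h o) C L)
    (hspec : ∀ g : G, stableLength d₁ g = stableLength d₂ g) :
    BddAbove (Set.range fun p : G × G => |d₁.dist p.1 p.2 - d₂.dist p.1 p.2|) := by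
  have hbdd : ∃ B, ∀ g : G, |d₁.dist 1 g - d₂.dist 1 g| ≤ B := by
    obtain ⟨f, D, r, hr, hext⟩ := exists_extension hX hcontr hindep hC hL
    obtain ⟨B₁, hB₁⟩ := hadd₁.exists_dist_le hX hcontr D
    obtain ⟨B₂, hB₂⟩ := hadd₂.exists_dist_le hX hcontr D
    obtain ⟨R₁, hR₁⟩ := hadd₁
    obtain ⟨R₂, hR₂⟩ := hadd₂
    have hsum : ∀ (d : PseudoMetricSpace G) (i : Fin 3), d.dist 1 (f i) ≤ ∑ j, d.dist 1 (f j) :=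
      fun d i => Finset.single_le_sum (f := fun j => d.dist 1 (f j))
        (fun j _ => @dist_nonneg G d 1 (f j)) (Finset.mem_univ i)
    have hshift : ∀ d : PseudoMetricSpace G, IsLeftInvariant d → ∀ (g : G) (i : Fin 3),
        |d.dist 1 (g * f i) - d.dist 1 g| ≤ ∑ j, d.dist 1 (f j) := by
      intro d hd g i
      have h1 := hd g 1 (f i)
      rw [mul_one] at h1
      have h2 := d.dist_triangle 1 g (g * f i)
      have h3 := d.dist_triangle 1 (g * f i) g
      have h4 : d.dist (g * f i) g = d.dist g (g * f i) := d.dist_comm _ _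
      have h5 := hsum d i
      rw [abs_le]
      constructor <;> linarith
    refine ⟨max (B₁ + B₂) (R₁ r + R₂ r + ∑ j, d₁.dist 1 (f j) + ∑ j, d₂.dist 1 (f j)),
      fun g => ?_⟩
    rcases le_or_gt (dist o (g • o)) D with hg | hg
    · refine le_max_of_le_left ?_
      have h1 : 0 ≤ d₁.dist 1 g := @dist_nonneg G d₁ 1 g
      have h2 : 0 ≤ d₂.dist 1 g := @dist_nonneg G d₂ 1 g
      rw [abs_le]
      constructor <;> linarith [hB₁ g hg, hB₂ g hg]
    · refine le_max_of_le_right ?_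
      obtain ⟨i, hi⟩ := hext g hg
      have h1 : |stableLength d₁ (g * f i) - d₁.dist 1 (g * f i)| ≤ R₁ r :=
        abs_stableLength_sub_le hd₁ fun n => by
          obtain ⟨γ, ℓ, hγ, h0, hℓ, hx⟩ := hi n
          exact hR₁ r hr 1 (g * f i) _ γ ℓ hγ (by rw [h0, one_smul]) hℓ hx
      have h2 : |stableLength d₂ (g * f i) - d₂.dist 1 (g * f i)| ≤ R₂ r :=
        abs_stableLength_sub_le hd₂ fun n => by
          obtain ⟨γ, ℓ, hγ, h0, hℓ, hx⟩ := hi n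
          exact hR₂ r hr 1 (g * f i) _ γ ℓ hγ (by rw [h0, one_smul]) hℓ hx
      have h3 := hshift d₁ hd₁ g i
      have h4 := hshift d₂ hd₂ g i
      rw [hspec, abs_le] at h1
      rw [abs_le] at h2 h3 h4 ⊢
      constructor <;> linarith [h1.1, h1.2, h2.1, h2.2, h3.1, h3.2, h4.1, h4.2]
  obtain ⟨B, hB⟩ := hbdd
  refine ⟨B, ?_⟩
  rintro _ ⟨⟨a, b⟩, rfl⟩
  have h1 := hd₁ a⁻¹ a b
  have h2 := hd₂ a⁻¹ a b
  rw [inv_mul_cancel] at h1 h2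
  simp only
  rw [← h1, ← h2]
  exact hB _
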